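/- All rings are commutative with identity. A ring $A$ is called a splinter if it is Noetherian and every finite ring map $A \to B$ for which $\operatorname{Spec}(B) \to \operatorname{Spec}(A)$ is surjective has a left inverse in the category of $A$-modules. For a local ring $(R,\mathfrak m)$, its Henselization is $R^h = \varinjlim_{(S,\mathfrak q)} S$, the filtered colimit over the category of pairs $(S,\mathfrak q)$ consisting of an étale $R$-algebra $S$ and a prime ideal $\mathfrak q$ of $S$ lying over $\mathfrak m$ such that $\kappa(\mathfrak m) \to \kappa(\mathfrak q)$ is an isomorphism (a morphism $(S,\mathfrak q) \to (S',\mathfrak q')$ is an $R$-algebra map $S \to S'$ under which $\mathfrak q$ is the preimage of $\mathfrak q'$). **Theorem B.** Let $(R,\mathfrak m)$ be a Noetherian local ring. Then $R$ is a splinter if and only if its Henselization $R^h$ is a splinter. -/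

import Mathlib

universe u

open CategoryTheory IsLocalRing

/-- A commutative ring `R` is a *splinter* if it is Noetherian and every finite ring map `R → S`
inducing a surjection `Spec S → Spec R` has a left inverse in the category of `R`-modules.
(A module-finite `R`-algebra is a quotient module of some `Rⁿ`, so up to isomorphism all of them
live in the universe of `R`.) -/
structure IsSplinter (R : Type u) [CommRing R] : Prop where
  isNoetherianRing : IsNoetherianRing R
  exists_leftInverse : ∀ (S : Type u) [CommRing S] [Algebra R S], Module.Finite R S →
    Function.Surjective (PrimeSpectrum.comap (algebraMap R S)) →
    ∃ φ : S →ₗ[R] R, φ ∘ₗ Algebra.linearMap R S = LinearMap.id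

/-- An étale neighbourhood `(S, q)` of a local ring `(R, m)`: an étale `R`-algebra `S` and a prime
`q` of `S` lying over `m` such that `κ(m) → κ(q)` is an isomorphism. An étale algebra is of
finite type, so up to isomorphism it is a quotient of some `R[x₁, …, xₙ]`; taking `S` literally of
this form makes the étale neighbourhoods a small category. -/
structure EtaleNhd (R : Type u) [CommRing R] [IsLocalRing R] : Type u where
  n : ℕ
  I : Ideal (MvPolynomial (Fin n) R)
  etale : Algebra.Etale R (MvPolynomial (Fin n) R ⧸ I)
  q : Ideal (MvPolynomial (Fin n) R ⧸ I)
  isPrime : q.IsPrime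
  liesOver : q.LiesOver (maximalIdeal R)
  bijective_residueField : Function.Bijective
    (Ideal.ResidueField.mapₐ (maximalIdeal R) q (Algebra.ofId R _) (q.over_def (maximalIdeal R)))

namespace EtaleNhd

variable {R : Type u} [CommRing R] [IsLocalRing R]

/-- The underlying étale `R`-algebra of an étale neighbourhood. -/
abbrev Ring (A : EtaleNhd R) : Type u := MvPolynomial (Fin A.n) R ⧸ A.I

/-- A morphism `(S, q) → (S', q')` of étale neighbourhoods is an `R`-algebra homomorphism
`S → S'` under which `q` is the preimage of `q'`. -/
@[ext]
structure Hom (A B : EtaleNhd R) : Type u where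
  toAlgHom : A.Ring →ₐ[R] B.Ring
  comap_eq : B.q.comap toAlgHom = A.q

noncomputable instance : SmallCategory (EtaleNhd R) where
  Hom A B := Hom A B
  id A := ⟨AlgHom.id R A.Ring, Ideal.comap_id A.q⟩
  comp f g := ⟨g.toAlgHom.comp f.toAlgHom, by
    rw [← f.comap_eq, ← g.comap_eq]; rfl⟩

/-- The forgetful functor `(S, q) ↦ S` to commutative rings. -/
noncomputable def forgetToRing (R : Type u) [CommRing R] [IsLocalRing R] : EtaleNhd R ⥤ CommRingCat.{u} where
  obj A := CommRingCat.of A.Ring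
  map f := CommRingCat.ofHom (Hom.toAlgHom f).toRingHom

end EtaleNhd

/-- The *Henselization* `Rʰ` of a local ring `(R, m)`: the (filtered) colimit of the rings `S` over
the category of all étale neighbourhoods `(S, q)` of `(R, m)`. -/
noncomputable def Henselization (R : Type u) [CommRing R] [IsLocalRing R] : Type u :=
  (Limits.colimit (EtaleNhd.forgetToRing R) : CommRingCat.{u})

noncomputable instance (R : Type u) [CommRing R] [IsLocalRing R] : CommRing (Henselization R) :=
  inferInstanceAs (CommRing (Limits.colimit (EtaleNhd.forgetToRing R) : CommRingCat.{u}))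

/-!
Call an algebra `A → B` pure if linear systems over `A` which are solvable in `B` are solvable in
`A`; for `B` finite over a Noetherian ring this is the same as being split. The local rings of étale
neighbourhoods are faithfully flat over each other, so `R → Rʰ` is pure. If `Rʰ` is a splinter, then
a finite `R`-algebra `S`, surjective on spectra, splits after base change to `Rʰ`, so `R → S` is
pure.

Conversely, a local splinter `R` is a domain and pure in its absolute integral closure `R⁺`, hence
in the product `P` of the localizations of `R⁺` at its maximal ideals. Each factor is local, and
monic polynomials over it split, so it is Henselian and receives a map from `Rʰ`. As `R` is dense in
the Noetherian local ring `Rʰ`, purity of `R → P` passes to `Rʰ → P`. Finally, the factors of `P`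
are integrally closed with algebraically closed fraction fields, so every finite `Rʰ`-algebra `T`
surjective on spectra maps to `P`; therefore `Rʰ → T` is pure, and so split.
-/

open scoped TensorProduct

/-! ### Pure algebras -/

theorem one_tmul_mkQ_range_eq_zero {A B ι κ : Type*} [CommRing A] [CommRing B] [Algebra A B]
    [Finite ι] [Fintype κ] {M : ι → κ → A} {r : ι → A} {t : κ → B}
    (ht : ∀ i, ∑ j, M i j • t j = algebraMap A B (r i)) :
    (1 : B) ⊗ₜ[A] (LinearMap.range (Matrix.mulVecLin (Matrix.of M))).mkQ r = 0 := by
  classical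
  cases nonempty_fintype ι
  set q := (LinearMap.range (Matrix.mulVecLin (Matrix.of M))).mkQ
  have hq (j : κ) : ∑ i, M i j • q (Pi.single i 1) = 0 := by
    simp_rw [← map_smul, ← map_sum]
    refine (Submodule.Quotient.mk_eq_zero _).mpr ⟨Pi.single j 1, ?_⟩
    ext i
    simp [Pi.single_apply]
  calc (1 : B) ⊗ₜ[A] q r
      = ∑ i, algebraMap A B (r i) ⊗ₜ[A] q (Pi.single i 1) := by
        conv_lhs => rw [pi_eq_sum_univ' r]
        simp [TensorProduct.tmul_sum, Algebra.algebraMap_eq_smul_one, TensorProduct.smul_tmul]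
    _ = ∑ j, t j ⊗ₜ[A] ∑ i, M i j • q (Pi.single i 1) := by
        simp only [← ht, TensorProduct.sum_tmul, TensorProduct.tmul_sum, TensorProduct.smul_tmul]
        exact Finset.sum_comm
    _ = 0 := by simp [hq]

theorem exists_forall_sum_mul_eq_of_mkQ_range_eq_zero {A ι κ : Type*} [CommRing A] [Fintype κ]
    {M : ι → κ → A} {r : ι → A}
    (hr : (LinearMap.range (Matrix.mulVecLin (Matrix.of M))).mkQ r = 0) :
    ∃ s : κ → A, ∀ i, ∑ j, M i j * s j = r i := by
  obtain ⟨s, hs⟩ := (Submodule.Quotient.mk_eq_zero _).mp hr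
  exact ⟨s, congrFun hs⟩

/-- An `A`-algebra `B` is *pure* if every finite system of linear equations over `A` which is
solvable in `B` is solvable in `A`. For `B` finite over a Noetherian ring `A` this says that
`A → B` has an `A`-linear left inverse, and it behaves better than splitting for large `B`. -/
def IsPureAlgebra (A B : Type*) [CommRing A] [CommRing B] [Algebra A B] : Prop :=
  ∀ ⦃ι κ : Type⦄ [Fintype ι] [Fintype κ] (M : ι → κ → A) (r : ι → A),
    (∃ t : κ → B, ∀ i, ∑ j, M i j • t j = algebraMap A B (r i)) →
      ∃ s : κ → A, ∀ i, ∑ j, M i j * s j = r i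

namespace IsPureAlgebra

variable {A B C : Type*} [CommRing A] [CommRing B] [CommRing C] [Algebra A B] [Algebra A C]

theorem of_leftInverse {φ : B →ₗ[A] A} (hφ : φ ∘ₗ Algebra.linearMap A B = LinearMap.id) :
    IsPureAlgebra A B := by
  rintro ι κ _ _ M r ⟨t, ht⟩
  refine ⟨fun j ↦ φ (t j), fun i ↦ ?_⟩
  calc ∑ j, M i j * φ (t j) = φ (algebraMap A B (r i)) := by simp [← ht i]
    _ = r i := DFunLike.congr_fun hφ (r i)

theorem of_algHom (f : B →ₐ[A] C) (h : IsPureAlgebra A C) : IsPureAlgebra A B := by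
  rintro ι κ _ _ M r ⟨t, ht⟩
  exact h M r ⟨fun j ↦ f (t j), fun i ↦ by simpa using congrArg f (ht i)⟩

theorem trans [Algebra B C] [IsScalarTower A B C] (hAB : IsPureAlgebra A B)
    (hBC : IsPureAlgebra B C) : IsPureAlgebra A C := by
  rintro ι κ _ _ M r ⟨t, ht⟩
  obtain ⟨s, hs⟩ := hBC (fun i j ↦ algebraMap A B (M i j)) (fun i ↦ algebraMap A B (r i))
    ⟨t, fun i ↦ by simpa [← IsScalarTower.algebraMap_apply] using ht i⟩
  exact hAB M r ⟨s, fun i ↦ by simpa [Algebra.smul_def] using hs i⟩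

theorem of_faithfullyFlat [Module.FaithfullyFlat A B] : IsPureAlgebra A B := by
  rintro ι κ _ _ M r ⟨t, ht⟩
  exact exists_forall_sum_mul_eq_of_mkQ_range_eq_zero
    (Module.FaithfullyFlat.tensorProduct_mk_injective (A := A) (B := B) _
      ((one_tmul_mkQ_range_eq_zero ht).trans (TensorProduct.tmul_zero _ _).symm))

theorem piLocalization : IsPureAlgebra A (MaximalSpectrum.PiLocalization A) := by
  rintro ι κ _ _ M r ⟨t, ht⟩
  refine exists_forall_sum_mul_eq_of_mkQ_range_eq_zero (Module.eq_zero_of_localization_maximal _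
    (fun P _ ↦ TensorProduct.mk A (Localization.AtPrime P) _ 1) _ fun P hP ↦ ?_)
  exact one_tmul_mkQ_range_eq_zero (t := fun j ↦ t j ⟨P, hP⟩) fun i ↦ by
    simpa using congrFun (ht i) ⟨P, hP⟩

theorem of_flat_of_isLocalHom [IsLocalRing A] [IsLocalRing B] [Module.Flat A B]
    [IsLocalHom (algebraMap A B)] : IsPureAlgebra A B :=
  have : Module.FaithfullyFlat A B := .of_flat_of_isLocalHom
  .of_faithfullyFlat

theorem of_isLocalization (S : Submonoid A) (L : Type*) [CommRing L] [Algebra A L] [Algebra L B]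
    [IsScalarTower A L B] [IsLocalization S L]
    (h : ∀ ⦃ι κ : Type⦄ [Fintype ι] [Fintype κ] (M : ι → κ → A) (r : ι → A),
      (∃ t : κ → B, ∀ i, ∑ j, M i j • t j = algebraMap A B (r i)) →
        ∃ s : κ → L, ∀ i, ∑ j, M i j • s j = algebraMap A L (r i)) :
    IsPureAlgebra L B := by
  rintro ι κ _ _ M r ⟨t, ht⟩
  obtain ⟨c, hc⟩ := IsLocalization.exist_integer_multiples_of_finite S
    (Sum.elim (fun p : ι × κ ↦ M p.1 p.2) r)
  choose M' hM' using fun i j ↦ hc (.inl (i, j))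
  choose r' hr' using fun i ↦ hc (.inr i)
  simp only [Sum.elim_inl, Sum.elim_inr] at hM' hr'
  have hB (i : ι) (j : κ) (x : B) : M' i j • x = (c : A) • M i j • x := by
    rw [← algebraMap_smul L, hM', smul_assoc]
  have hL (i : ι) (j : κ) (x : L) : M' i j • x = (c : A) • (M i j * x) := by
    rw [Algebra.smul_def, hM', smul_mul_assoc]
  obtain ⟨s, hs⟩ := h M' r' ⟨t, fun i ↦ by
    rw [IsScalarTower.algebraMap_apply A L B, hr', Algebra.algebraMap_eq_smul_one,
      smul_assoc, ← Algebra.algebraMap_eq_smul_one, ← ht, Finset.smul_sum]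
    simp only [hB]⟩
  refine ⟨s, fun i ↦ (IsLocalization.map_units L c).mul_left_cancel ?_⟩
  rw [← Algebra.smul_def, ← Algebra.smul_def, ← hr', ← hs, Finset.smul_sum]
  simp only [hL]

theorem exists_sum_smul_eq_localization_of_flat [Module.Flat A B] (p : Ideal A) [p.IsPrime]
    (P : Ideal B) [P.IsPrime] [P.LiesOver p] {ι κ : Type} [Finite ι] [Fintype κ] {M : ι → κ → A}
    {r : ι → A} {t : κ → B} (ht : ∀ i, ∑ j, M i j • t j = algebraMap A B (r i)) :
    ∃ s : κ → Localization.AtPrime p,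
      ∀ i, ∑ j, M i j • s j = algebraMap A (Localization.AtPrime p) (r i) := by
  cases nonempty_fintype ι
  let := Localization.AtPrime.algebraOfLiesOver p P
  have : IsLocalHom (algebraMap (Localization.AtPrime p) (Localization.AtPrime P)) := by
    rw [RingHom.algebraMap_toAlgebra]
    exact Localization.isLocalHom_localRingHom p P _ Ideal.LiesOver.over
  have hpure : IsPureAlgebra (Localization.AtPrime p) (Localization.AtPrime P) :=
    .of_flat_of_isLocalHom
  obtain ⟨s, hs⟩ := hpure (fun i j ↦ algebraMap A _ (M i j)) (fun i ↦ algebraMap A _ (r i))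
    ⟨fun j ↦ algebraMap B _ (t j), fun i ↦ by
      simpa [← IsScalarTower.algebraMap_apply, Algebra.smul_def]
        using congrArg (algebraMap B (Localization.AtPrime P)) (ht i)⟩
  exact ⟨s, fun i ↦ by simpa [Algebra.smul_def] using hs i⟩

/-- The coefficients expressing the error terms through elements of `I` become additional unknowns
of the system. -/
theorem exists_forall_sum_sub_mem (h : IsPureAlgebra A B) (I : Ideal A) {ι κ : Type} [Finite ι]
    [Fintype κ] (M : ι → κ → A) (r : ι → A) {t : κ → B}
    (ht : ∀ i, ∑ j, M i j • t j - algebraMap A B (r i) ∈ I.map (algebraMap A B)) :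
    ∃ s : κ → A, ∀ i, ∑ j, M i j * s j - r i ∈ I := by
  classical
  cases nonempty_fintype ι
  choose n b g hbg using fun i ↦ Submodule.mem_span_set'.mp (ht i)
  choose a ha hag using fun i l ↦ (g i l).2
  obtain ⟨s, hs⟩ := h (κ := κ ⊕ Σ i, Fin (n i))
    (fun i ↦ Sum.elim (M i) fun p ↦ if p.1 = i then -a p.1 p.2 else 0) r
    ⟨Sum.elim t fun p ↦ b p.1 p.2, fun i ↦ by
      simp only [Fintype.sum_sum_type, Sum.elim_inl, Sum.elim_inr, Fintype.sum_sigma, ite_smul,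
        zero_smul, Finset.sum_ite_irrel, Finset.sum_const_zero, Finset.sum_ite_eq',
        Finset.mem_univ, if_true, neg_smul, Finset.sum_neg_distrib]
      rw [← sub_eq_add_neg, sub_eq_iff_eq_add, ← sub_eq_iff_eq_add', ← hbg i]
      exact Finset.sum_congr rfl fun l _ ↦ by
        rw [smul_eq_mul, mul_comm, ← hag, Algebra.smul_def]⟩
  refine ⟨fun j ↦ s (.inl j), fun i ↦ ?_⟩
  rw [← hs i, Fintype.sum_sum_type]
  simp only [Sum.elim_inl, Sum.elim_inr, sub_add_cancel_left]
  refine neg_mem (sum_mem fun p _ ↦ Ideal.mul_mem_right _ _ ?_)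
  split_ifs
  · exact neg_mem (ha _ _)
  · exact zero_mem _

theorem comap_map_eq (h : IsPureAlgebra A B) (I : Ideal A) :
    (I.map (algebraMap A B)).comap (algebraMap A B) = I := by
  refine le_antisymm (fun x hx ↦ ?_) Ideal.le_comap_map
  obtain ⟨_, hs⟩ := h.exists_forall_sum_sub_mem I (ι := Unit) (κ := Empty) (t := nofun) nofun
    (fun _ ↦ x) (by simpa using hx)
  simpa using hs ()

theorem isNoetherianRing [IsNoetherianRing B] (h : IsPureAlgebra A B) : IsNoetherianRing A := by
  have hmono : StrictMono (Ideal.map (algebraMap A B)) := Monotone.strictMono_of_injective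
    (fun _ _ ↦ Ideal.map_mono) (Function.LeftInverse.injective h.comap_map_eq)
  exact isNoetherian_iff'.mpr hmono.wellFoundedGT

theorem exists_leftInverse [IsNoetherianRing A] [Module.Finite A B] (h : IsPureAlgebra A B) :
    ∃ φ : B →ₗ[A] A, φ ∘ₗ Algebra.linearMap A B = LinearMap.id := by
  obtain ⟨n, f, hf⟩ := Module.Finite.exists_fin' A B
  obtain ⟨m, v, hv⟩ := Submodule.fg_iff_exists_fin_generating_family.mp
    (IsNoetherian.noetherian (LinearMap.ker f))
  obtain ⟨e, he⟩ := hf 1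
  have hsum (x : Fin n → A) : ∑ j, x j • f (Pi.single j 1) = f x := by
    conv_rhs => rw [pi_eq_sum_univ' x]
    simp
  have hvf (i : Fin m) : f (v i) = 0 :=
    LinearMap.mem_ker.mp (hv ▸ Submodule.subset_span ⟨i, rfl⟩)
  -- A left inverse is a linear form on `Aⁿ` vanishing on the relations `v i` with value `1` at `e`.
  obtain ⟨s, hs⟩ := h (ι := Option (Fin m)) (fun i j ↦ i.elim (e j) fun i ↦ v i j)
    (fun i ↦ i.elim 1 fun _ ↦ 0) ⟨fun j ↦ f (Pi.single j 1), fun i ↦ by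
      cases i with
      | none => simpa [he] using hsum e
      | some i => simpa [hvf] using hsum (v i)⟩
  let g : (Fin n → A) →ₗ[A] A := ∑ j, s j • LinearMap.proj j
  have hg (x : Fin n → A) : g x = ∑ j, x j * s j := by simp [g, mul_comm]
  have hker : LinearMap.ker f ≤ LinearMap.ker g := by
    rw [← hv, Submodule.span_le]
    rintro _ ⟨i, rfl⟩
    simpa [hg] using hs (some i)
  refine ⟨(LinearMap.ker f).liftQ g hker ∘ₗ (f.quotKerEquivOfSurjective hf).symm.toLinearMap, ?_⟩
  ext
  have he' : (f.quotKerEquivOfSurjective hf).symm 1 = Submodule.Quotient.mk e := by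
    rw [LinearEquiv.symm_apply_eq]
    simpa using he.symm
  simpa [he', hg] using hs none

end IsPureAlgebra

/-! ### Dense subrings -/

theorem mem_of_forall_mem_sup_pow_smul_top {R M : Type*} [CommRing R] [IsNoetherianRing R]
    [AddCommGroup M] [Module R M] [Module.Finite R M] {I : Ideal R} (hI : I ≤ Ideal.jacobson ⊥)
    {N : Submodule R M} {x : M} (h : ∀ k, x ∈ N ⊔ I ^ k • (⊤ : Submodule R M)) : x ∈ N := by
  rw [← Submodule.Quotient.mk_eq_zero]
  refine (IsHausdorff.of_le_jacobson I (M ⧸ N) hI).haus _ fun k ↦ ?_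
  rw [SModEq.zero]
  have := Submodule.mem_map_of_mem (f := N.mkQ) (h k)
  rwa [Submodule.map_sup, Submodule.mkQ_map_self, bot_sup_eq, Submodule.map_smul'',
    Submodule.map_top, Submodule.range_mkQ] at this

theorem mem_smul_top_of_forall_mem {R ι : Type*} [CommRing R] [Finite ι] {I : Ideal R}
    {v : ι → R} (hv : ∀ i, v i ∈ I) : v ∈ I • (⊤ : Submodule R (ι → R)) := by
  classical
  have := Fintype.ofFinite ι
  rw [pi_eq_sum_univ' v]
  exact sum_mem fun i _ ↦ Submodule.smul_mem_smul (hv i) trivial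

theorem exists_forall_sum_mul_eq_of_forall_pow {A ι κ : Type*} [CommRing A] [IsNoetherianRing A]
    [Finite ι] [Fintype κ] {I : Ideal A} (hI : I ≤ Ideal.jacobson ⊥) (M : ι → κ → A) (r : ι → A)
    (h : ∀ k, ∃ s : κ → A, ∀ i, r i - ∑ j, M i j * s j ∈ I ^ k) :
    ∃ s : κ → A, ∀ i, ∑ j, M i j * s j = r i := by
  have hr : r ∈ LinearMap.range (Matrix.mulVecLin (Matrix.of M)) := by
    refine mem_of_forall_mem_sup_pow_smul_top hI fun k ↦ ?_
    obtain ⟨s, hs⟩ := h k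
    rw [← add_sub_cancel (Matrix.mulVecLin (Matrix.of M) s) r]
    exact Submodule.add_mem_sup (LinearMap.mem_range_self _ s) (mem_smul_top_of_forall_mem hs)
  obtain ⟨s, hs⟩ := hr
  exact ⟨s, congrFun hs⟩

section Dense

variable {R H : Type*} [CommRing R] [CommRing H] [Algebra R H] {I : Ideal R}

theorem exists_mem_pow_sub_mem_map_pow
    (hd : ∀ x : H, ∃ r : R, x - algebraMap R H r ∈ I.map (algebraMap R H)) (k : ℕ) {x : H}
    (hx : x ∈ (I ^ k).map (algebraMap R H)) :
    ∃ r ∈ I ^ k, x - algebraMap R H r ∈ (I ^ (k + 1)).map (algebraMap R H) := by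
  refine Submodule.span_induction (p := fun x _ ↦ ∃ r ∈ I ^ k,
    x - algebraMap R H r ∈ (I ^ (k + 1)).map (algebraMap R H)) ?_ ?_ ?_ ?_ hx
  · rintro _ ⟨r, hr, rfl⟩
    exact ⟨r, hr, by simp⟩
  · exact ⟨0, zero_mem _, by simp⟩
  · rintro x y - - ⟨r, hr, hxr⟩ ⟨s, hs, hys⟩
    refine ⟨r + s, add_mem hr hs, ?_⟩
    rw [map_add, add_sub_add_comm]
    exact add_mem hxr hys
  · rintro a x - ⟨r, hr, hxr⟩
    obtain ⟨b, hb⟩ := hd a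
    refine ⟨b * r, Ideal.mul_mem_left _ _ hr, ?_⟩
    have hsplit : a • x - algebraMap R H (b * r) =
        a * (x - algebraMap R H r) + algebraMap R H r * (a - algebraMap R H b) := by
      simp only [map_mul, smul_eq_mul]
      ring
    rw [hsplit]
    refine add_mem (Ideal.mul_mem_left _ _ hxr) ?_
    rw [pow_succ, Ideal.map_mul]
    exact Ideal.mul_mem_mul (Ideal.mem_map_of_mem _ hr) hb

theorem exists_sub_mem_map_pow
    (hd : ∀ x : H, ∃ r : R, x - algebraMap R H r ∈ I.map (algebraMap R H)) (k : ℕ) (x : H) :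
    ∃ r : R, x - algebraMap R H r ∈ (I ^ k).map (algebraMap R H) := by
  induction k with
  | zero => exact ⟨0, by simp [Ideal.map_top]⟩
  | succ k ih =>
    obtain ⟨r, hr⟩ := ih
    obtain ⟨s, -, hs⟩ := exists_mem_pow_sub_mem_map_pow hd k hr
    exact ⟨r + s, by rwa [map_add, ← sub_sub]⟩

/-- The elements of the Rees algebra of `I` whose coefficients are leading forms of elements of
the ideal `J` of the `R`-algebra `H`. When `R → H` has dense image in the `I`-adic topology, these
play the role of the initial ideal of `J` in the associated graded ring. -/
def leadingForms (I : Ideal R) (J : Ideal H) : Ideal (reesAlgebra I) where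
  carrier := {f | ∀ k, ∃ j ∈ J,
    algebraMap R H (f.1.coeff k) - j ∈ (I ^ (k + 1)).map (algebraMap R H)}
  zero_mem' k := ⟨0, zero_mem _, by simp⟩
  add_mem' {f g} hf hg k := by
    obtain ⟨a, ha, hfa⟩ := hf k
    obtain ⟨b, hb, hgb⟩ := hg k
    refine ⟨a + b, add_mem ha hb, ?_⟩
    simpa [add_sub_add_comm] using add_mem hfa hgb
  smul_mem' g f hf k := by
    choose j hj hfj using hf
    refine ⟨∑ p ∈ Finset.HasAntidiagonal.antidiagonal k, algebraMap R H (g.1.coeff p.1) * j p.2,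
      Ideal.sum_mem _ fun p _ ↦ Ideal.mul_mem_left _ _ (hj _), ?_⟩
    simp only [smul_eq_mul, MulMemClass.coe_mul, Polynomial.coeff_mul, map_sum, map_mul,
      ← Finset.sum_sub_distrib, ← mul_sub]
    refine Ideal.sum_mem _ fun p hp ↦ ?_
    rw [← Finset.HasAntidiagonal.mem_antidiagonal.mp hp, add_assoc, pow_add, Ideal.map_mul]
    exact Ideal.mul_mem_mul (Ideal.mem_map_of_mem _ ((mem_reesAlgebra_iff I _).mp g.2 _)) (hfj _)

theorem exists_fg_le_and_leadingForms_le [IsNoetherianRing R] (I : Ideal R) (J : Ideal H) :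
    ∃ J₀ ≤ J, J₀.FG ∧ leadingForms I J ≤ leadingForms I J₀ := by
  obtain ⟨s, hs⟩ := IsNoetherian.noetherian (leadingForms I J)
  have hmem (F : s) : F.1 ∈ leadingForms I J := hs ▸ Submodule.subset_span F.2
  choose j hj hFj using hmem
  refine ⟨Ideal.span (⋃ F : s, j F '' F.1.1.support), Ideal.span_le.mpr ?_,
    Submodule.fg_span (Set.finite_iUnion fun F ↦ F.1.1.support.finite_toSet.image _), ?_⟩
  · exact Set.iUnion_subset fun F ↦ Set.image_subset_iff.mpr fun k _ ↦ hj F k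
  rw [← hs, Submodule.span_le]
  intro F hF k
  by_cases hk : k ∈ F.1.support
  · exact ⟨j ⟨F, hF⟩ k, Ideal.subset_span (Set.mem_iUnion.mpr ⟨⟨F, hF⟩, k, hk, rfl⟩), hFj ⟨F, hF⟩ k⟩
  · exact ⟨0, zero_mem _, by simp [Polynomial.notMem_support_iff.mp hk]⟩

theorem le_sup_map_pow_of_leadingForms_le
    (hd : ∀ x : H, ∃ r : R, x - algebraMap R H r ∈ I.map (algebraMap R H)) {J₀ J : Ideal H}
    (hJ : J₀ ≤ J) (h : leadingForms I J ≤ leadingForms I J₀) (k : ℕ) :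
    J ≤ J₀ ⊔ (I ^ k).map (algebraMap R H) := by
  suffices ∀ y ∈ J, ∃ z ∈ J₀, y - z ∈ (I ^ k).map (algebraMap R H) by
    intro y hy
    obtain ⟨z, hz, hyz⟩ := this y hy
    exact Submodule.mem_sup.mpr ⟨z, hz, y - z, hyz, add_sub_cancel z y⟩
  intro y hy
  induction k with
  | zero => exact ⟨0, zero_mem _, by simp [Ideal.map_top]⟩
  | succ k ih =>
    obtain ⟨z, hz, hyz⟩ := ih
    obtain ⟨a, ha, hya⟩ := exists_mem_pow_sub_mem_map_pow hd k hyz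
    have hmon : (⟨Polynomial.monomial k a, reesAlgebra.monomial_mem.mpr ha⟩ : reesAlgebra I) ∈
        leadingForms I J := by
      intro l
      obtain rfl | hl := eq_or_ne k l
      · exact ⟨y - z, sub_mem hy (hJ hz), by simpa using neg_mem hya⟩
      · exact ⟨0, zero_mem _, by simp [Polynomial.coeff_monomial, hl]⟩
    obtain ⟨w, hw, haw⟩ := h hmon k
    refine ⟨z + w, add_mem hz hw, ?_⟩
    rw [Polynomial.coeff_monomial_same] at haw
    convert add_mem hya haw using 1
    ring

theorem isNoetherianRing_of_dense [IsNoetherianRing R]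
    (hd : ∀ x : H, ∃ r : R, x - algebraMap R H r ∈ I.map (algebraMap R H))
    (hclosed : ∀ J : Ideal H, J.FG → ∀ y, (∀ k, y ∈ J ⊔ (I ^ k).map (algebraMap R H)) → y ∈ J) :
    IsNoetherianRing H := by
  rw [isNoetherianRing_iff_ideal_fg]
  intro J
  obtain ⟨J₀, hJ₀, hfg, hlead⟩ := exists_fg_le_and_leadingForms_le I J
  have hJ : J ≤ J₀ := fun y hy ↦
    hclosed J₀ hfg y fun k ↦ le_sup_map_pow_of_leadingForms_le hd hJ₀ hlead k hy
  exact le_antisymm hJ hJ₀ ▸ hfg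

/-- Modulo each power of `I`, a linear system over `H` comes from `R`. -/
theorem IsPureAlgebra.of_dense [IsNoetherianRing H]
    (hd : ∀ x : H, ∃ r : R, x - algebraMap R H r ∈ I.map (algebraMap R H))
    (hI : I.map (algebraMap R H) ≤ Ideal.jacobson ⊥) {B : Type*} [CommRing B] [Algebra R B]
    [Algebra H B] [IsScalarTower R H B] (hB : IsPureAlgebra R B) : IsPureAlgebra H B := by
  rintro ι κ _ _ M r ⟨t, ht⟩
  refine exists_forall_sum_mul_eq_of_forall_pow hI M r fun k ↦ ?_
  rw [← Ideal.map_pow]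
  choose M₀ hM using fun i j ↦ exists_sub_mem_map_pow hd k (M i j)
  choose r₀ hr using fun i ↦ exists_sub_mem_map_pow hd k (r i)
  have hmap {x : H} (hx : x ∈ (I ^ k).map (algebraMap R H)) :
      algebraMap H B x ∈ (I ^ k).map (algebraMap R B) := by
    have := Ideal.mem_map_of_mem (algebraMap H B) hx
    rwa [Ideal.map_map, ← IsScalarTower.algebraMap_eq] at this
  have ht₀ (i : ι) :
      ∑ j, M₀ i j • t j - algebraMap R B (r₀ i) ∈ (I ^ k).map (algebraMap R B) := by
    have hsplit : ∑ j, M₀ i j • t j - algebraMap R B (r₀ i) =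
        algebraMap H B (r i - algebraMap R H (r₀ i)) -
          ∑ j, algebraMap H B (M i j - algebraMap R H (M₀ i j)) * t j := by
      simp only [map_sub, ← ht, sub_mul, Finset.sum_sub_distrib, Algebra.smul_def,
        ← IsScalarTower.algebraMap_apply]
      ring
    rw [hsplit]
    exact sub_mem (hmap (hr i)) (sum_mem fun j _ ↦ Ideal.mul_mem_right _ _ (hmap (hM i j)))
  obtain ⟨s, hs⟩ := hB.exists_forall_sum_sub_mem (I ^ k) M₀ r₀ ht₀
  refine ⟨fun j ↦ algebraMap R H (s j), fun i ↦ ?_⟩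
  have hsplit : r i - ∑ j, M i j * algebraMap R H (s j) =
      (r i - algebraMap R H (r₀ i)) - algebraMap R H (∑ j, M₀ i j * s j - r₀ i) -
        ∑ j, (M i j - algebraMap R H (M₀ i j)) * algebraMap R H (s j) := by
    simp only [map_sub, map_sum, map_mul, sub_mul, Finset.sum_sub_distrib]
    ring
  rw [hsplit]
  exact sub_mem (sub_mem (hr i) (Ideal.mem_map_of_mem _ (hs i)))
    (sum_mem fun j _ ↦ Ideal.mul_mem_right _ _ (hM i j))

end Dense

/-! ### Étale algebras over local rings -/

section Unramified

variable {R S C : Type*} [CommRing R] [CommRing S] [CommRing C] [Algebra R S] [Algebra R C]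
  [Algebra.FormallyUnramified R S] [Algebra.EssFiniteType R S]

/-- The diagonal of an unramified algebra is cut out by an idempotent. -/
theorem exists_isIdempotentElem_span_range_sub_eq (f g : S →ₐ[R] C) :
    ∃ e : C, IsIdempotentElem e ∧ Ideal.span (Set.range fun x ↦ f x - g x) = Ideal.span {e} := by
  let φ : S ⊗[R] S →ₐ[R] C := Algebra.TensorProduct.lift g f fun _ _ ↦ .all _ _
  have hmap : (KaehlerDifferential.ideal R S).map φ = Ideal.span (Set.range fun x ↦ f x - g x) := by
    rw [← KaehlerDifferential.span_range_eq_ideal, Ideal.map_span, ← Set.range_comp]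
    congr with x
    simp [φ]
  have hidem : IsIdempotentElem (KaehlerDifferential.ideal R S) :=
    (Ideal.cotangent_subsingleton_iff _).mp
      (inferInstance : Subsingleton (KaehlerDifferential R S))
  obtain ⟨e, he, heq⟩ := (Ideal.isIdempotentElem_iff_of_fg _
    (KaehlerDifferential.ideal_fg R S)).mp hidem
  refine ⟨φ e, he.map φ, ?_⟩
  rw [← hmap, heq, Ideal.submodule_span_eq, Ideal.map_span, Set.image_singleton]

theorem algHom_ext_of_sub_mem_maximalIdeal [IsLocalRing C] {f g : S →ₐ[R] C}
    (h : ∀ x, f x - g x ∈ maximalIdeal C) : f = g := by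
  obtain ⟨e, he, hspan⟩ := exists_isIdempotentElem_span_range_sub_eq f g
  have hem : e ∈ maximalIdeal C := by
    have : Ideal.span {e} ≤ maximalIdeal C :=
      hspan ▸ Ideal.span_le.mpr (Set.range_subset_iff.mpr h)
    exact this (Ideal.mem_span_singleton_self e)
  have he0 : e = 0 := (isUnit_one_sub_self_of_mem_nonunits e hem).mul_left_eq_zero.mp
    he.mul_one_sub_self
  ext x
  have hx : f x - g x ∈ Ideal.span {e} := hspan ▸ Ideal.subset_span ⟨x, rfl⟩
  simpa [he0, sub_eq_zero] using hx

end Unramified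

section HenselLift

variable {R C : Type*} [CommRing R] [CommRing C] [Algebra R C] [HenselianLocalRing C]

theorem exists_hasMap_residue_eq (P : StandardEtalePair R) {x : ResidueField C} (hx : P.HasMap x) :
    ∃ c : C, P.HasMap c ∧ residue C c = x := by
  obtain ⟨a, rfl⟩ := residue_surjective x
  have haeval (p : Polynomial R) (b : C) :
      Polynomial.aeval (residue C b) p = residue C (Polynomial.aeval b p) := by
    simpa using Polynomial.aeval_algebraMap_apply (ResidueField C) b p
  have hunit {p : Polynomial R} {b : C} (hp : IsUnit (Polynomial.aeval (residue C b) p)) :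
      IsUnit (Polynomial.aeval b p) := by
    rwa [haeval, isUnit_map_iff] at hp
  obtain ⟨c, hc, hca⟩ := HenselianLocalRing.is_henselian (P.f.map (algebraMap R C))
    (P.monic_f.map _) a
    (by simpa [Polynomial.eval_map_algebraMap, haeval] using hx.1)
    (by simpa [Polynomial.derivative_map, Polynomial.eval_map_algebraMap] using
      hunit hx.isUnit_derivative_f)
  have hres : residue C c = residue C a := by
    rwa [← sub_eq_zero, ← map_sub, residue_eq_zero_iff]
  exact ⟨c, ⟨by simpa [Polynomial.IsRoot, Polynomial.eval_map_algebraMap] using hc,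
    hunit (hres ▸ hx.2)⟩, hres⟩

theorem exists_algHom_residue_comp_eq {S : Type*} [CommRing S] [Algebra R S] [Algebra.Etale R S]
    (ρ : S →ₐ[R] ResidueField C) :
    ∃ f : S →ₐ[R] C, (IsScalarTower.toAlgHom R C (ResidueField C)).comp f = ρ := by
  have := RingHom.ker_isPrime ρ
  obtain ⟨s, hs, hstd⟩ := Algebra.IsEtaleAt.exists_isStandardEtale (R := R) (RingHom.ker ρ)
  obtain ⟨P⟩ := hstd.nonempty_standardEtalePresentation
  let ρs : Localization.Away s →ₐ[R] ResidueField C :=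
    IsLocalization.Away.liftAlgHom s (f := ρ) (isUnit_iff_ne_zero.mpr hs)
  obtain ⟨c, hc, hcρ⟩ := exists_hasMap_residue_eq P.P (P.hasMap.map ρs)
  let fs : Localization.Away s →ₐ[R] C := (P.lift c hc).comp P.equivRing.toAlgHom
  have hfs : (IsScalarTower.toAlgHom R C (ResidueField C)).comp fs = ρs :=
    P.hom_ext (by simpa [fs] using hcρ)
  refine ⟨fs.comp (IsScalarTower.toAlgHom R S _), ?_⟩
  rw [← AlgHom.comp_assoc, hfs]
  ext x
  simp [ρs]

end HenselLift

section RationalPoint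

variable {R S : Type*} [CommRing R] [IsLocalRing R] [CommRing S] [Algebra R S]

theorem algHom_residueField_ext_of_ker_eq {σ τ : S →ₐ[R] (maximalIdeal R).ResidueField}
    (h : RingHom.ker σ = RingHom.ker τ) : σ = τ := by
  ext x
  obtain ⟨r, hr⟩ := (maximalIdeal R).algebraMap_residueField_surjective (σ x)
  have : x - algebraMap R S r ∈ RingHom.ker σ := by simp [RingHom.mem_ker, hr]
  rw [h, RingHom.mem_ker, map_sub, AlgHom.commutes, hr, sub_eq_zero] at this
  exact this.symm

theorem ker_algHom_residueField_liesOver (σ : S →ₐ[R] (maximalIdeal R).ResidueField) :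
    (RingHom.ker σ).LiesOver (maximalIdeal R) :=
  ⟨by ext r; simp [Ideal.mem_comap, RingHom.mem_ker]⟩

theorem bijective_mapₐ_residueField_ker (σ : S →ₐ[R] (maximalIdeal R).ResidueField)
    [(RingHom.ker σ).IsPrime] (h : maximalIdeal R = (RingHom.ker σ).comap (Algebra.ofId R S)) :
    Function.Bijective
      (Ideal.ResidueField.mapₐ (maximalIdeal R) (RingHom.ker σ) (Algebra.ofId R S) h) := by
  have hmax : (RingHom.ker σ).IsMaximal := RingHom.ker_isMaximal_of_surjective σ fun y ↦ by
    obtain ⟨r, rfl⟩ := (maximalIdeal R).algebraMap_residueField_surjective y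
    exact ⟨algebraMap R _ r, σ.commutes r⟩
  refine ⟨RingHom.injective _, fun y ↦ ?_⟩
  obtain ⟨x, rfl⟩ := (RingHom.ker σ).algebraMap_residueField_surjective y
  obtain ⟨r, hr⟩ := (maximalIdeal R).algebraMap_residueField_surjective (σ x)
  refine ⟨algebraMap R _ r, ?_⟩
  rw [AlgHom.commutes, eq_comm, ← sub_eq_zero,
    IsScalarTower.algebraMap_apply R S (RingHom.ker σ).ResidueField, ← map_sub,
    Ideal.algebraMap_residueField_eq_zero]
  simp [RingHom.mem_ker, hr]

end RationalPoint

namespace EtaleNhd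

variable {R : Type u} [CommRing R] [IsLocalRing R]

instance (A : EtaleNhd R) : Algebra.Etale R A.Ring := A.etale

instance (A : EtaleNhd R) : A.q.IsPrime := A.isPrime

instance (A : EtaleNhd R) : A.q.LiesOver (maximalIdeal R) := A.liesOver

/-- The evaluation of functions at the distinguished point `q`, with values in the residue field
of `R`. Morphisms of étale neighbourhoods are the algebra maps compatible with these evaluations. -/
noncomputable def residueMap (A : EtaleNhd R) : A.Ring →ₐ[R] (maximalIdeal R).ResidueField :=
  (AlgEquiv.ofBijective _ A.bijective_residueField).symm.toAlgHom.comp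
    (IsScalarTower.toAlgHom R A.Ring A.q.ResidueField)

theorem residueMap_eq_zero_iff (A : EtaleNhd R) {x : A.Ring} : A.residueMap x = 0 ↔ x ∈ A.q := by
  simp [residueMap]

theorem ker_residueMap (A : EtaleNhd R) : RingHom.ker A.residueMap = A.q :=
  Ideal.ext fun _ ↦ A.residueMap_eq_zero_iff

theorem isUnit_residueMap (A : EtaleNhd R) {s : A.Ring} (hs : s ∉ A.q) :
    IsUnit (A.residueMap s) := by
  rwa [isUnit_iff_ne_zero, Ne, residueMap_eq_zero_iff]

theorem exists_sub_mem (A : EtaleNhd R) (x : A.Ring) :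
    ∃ r : R, x - algebraMap R A.Ring r ∈ A.q := by
  obtain ⟨r, hr⟩ := (maximalIdeal R).algebraMap_residueField_surjective (A.residueMap x)
  exact ⟨r, by rw [← residueMap_eq_zero_iff, map_sub, AlgHom.commutes, hr, sub_self]⟩

theorem residueMap_comp {A B : EtaleNhd R} (f : A ⟶ B) :
    B.residueMap.comp (Hom.toAlgHom f) = A.residueMap :=
  algHom_residueField_ext_of_ker_eq <| by
    rw [ker_residueMap, ← f.comap_eq, ← ker_residueMap]
    rfl

/-- Constructs a morphism of étale neighbourhoods from compatibility with the residue maps. -/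
def homMk {A B : EtaleNhd R} (f : A.Ring →ₐ[R] B.Ring)
    (h : B.residueMap.comp f = A.residueMap) : A ⟶ B :=
  Hom.mk f (by rw [← ker_residueMap, ← ker_residueMap, ← h]; rfl)

theorem exists_algEquiv_of_algHom_residueField (S : Type u) [CommRing S] [Algebra R S]
    [Algebra.Etale R S] (ρ : S →ₐ[R] (maximalIdeal R).ResidueField) :
    ∃ (A : EtaleNhd R) (e : A.Ring ≃ₐ[R] S), A.residueMap = ρ.comp e.toAlgHom := by
  obtain ⟨n, f, hf⟩ := Algebra.FiniteType.iff_quotient_mvPolynomial''.mp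
    (inferInstance : Algebra.FiniteType R S)
  let e : (MvPolynomial (Fin n) R ⧸ RingHom.ker f) ≃ₐ[R] S :=
    Ideal.quotientKerAlgEquivOfSurjective hf
  let σ := ρ.comp e.toAlgHom
  have := RingHom.ker_isPrime σ
  let A : EtaleNhd R :=
    { n := n
      I := RingHom.ker f
      etale := .of_equiv e.symm
      q := RingHom.ker σ
      isPrime := this
      liesOver := ker_algHom_residueField_liesOver σ
      bijective_residueField := bijective_mapₐ_residueField_ker σ _ }
  exact ⟨A, e, algHom_residueField_ext_of_ker_eq A.ker_residueMap⟩

theorem exists_nonempty_hom_nonempty_hom (A B : EtaleNhd R) :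
    ∃ C : EtaleNhd R, Nonempty (A ⟶ C) ∧ Nonempty (B ⟶ C) := by
  have : Algebra.Etale R (A.Ring ⊗[R] B.Ring) := Algebra.Etale.comp R A.Ring _
  obtain ⟨C, e, he⟩ := exists_algEquiv_of_algHom_residueField (A.Ring ⊗[R] B.Ring)
    (Algebra.TensorProduct.lift A.residueMap B.residueMap fun _ _ ↦ .all _ _)
  refine ⟨C, ⟨homMk (e.symm.toAlgHom.comp Algebra.TensorProduct.includeLeft) ?_⟩,
    ⟨homMk (e.symm.toAlgHom.comp Algebra.TensorProduct.includeRight) ?_⟩⟩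
  all_goals ext x; simp [he]

theorem exists_hom_isUnit (A : EtaleNhd R) {s : A.Ring} (hs : s ∉ A.q) :
    ∃ (C : EtaleNhd R) (f : A ⟶ C), IsUnit (Hom.toAlgHom f s) := by
  obtain ⟨C, e, he⟩ := exists_algEquiv_of_algHom_residueField (Localization.Away s)
    (IsLocalization.Away.liftAlgHom s (f := A.residueMap) (A.isUnit_residueMap hs))
  refine ⟨C, homMk (e.symm.toAlgHom.comp (IsScalarTower.toAlgHom R A.Ring _)) ?_, ?_⟩
  · ext x; simp [he]
  · exact (IsLocalization.Away.algebraMap_isUnit s).map e.symm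

/-- Invert the complement of the idempotent which cuts out the equalizer. -/
theorem exists_comp_eq_comp {A B : EtaleNhd R} (f g : A ⟶ B) :
    ∃ (C : EtaleNhd R) (h : B ⟶ C), f ≫ h = g ≫ h := by
  obtain ⟨e, he, hspan⟩ :=
    exists_isIdempotentElem_span_range_sub_eq (Hom.toAlgHom f) (Hom.toAlgHom g)
  have hle : Ideal.span {e} ≤ B.q := by
    rw [← hspan, Ideal.span_le, Set.range_subset_iff]
    intro x
    rw [SetLike.mem_coe, ← residueMap_eq_zero_iff, map_sub, sub_eq_zero]
    exact DFunLike.congr_fun ((residueMap_comp f).trans (residueMap_comp g).symm) x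
  have heq : e ∈ B.q := hle (Ideal.mem_span_singleton_self e)
  have hs : 1 - e ∉ B.q := fun h ↦
    B.isPrime.ne_top ((Ideal.eq_top_iff_one _).mpr (by simpa using add_mem h heq))
  obtain ⟨C, h, hu⟩ := B.exists_hom_isUnit hs
  have hhe : Hom.toAlgHom h e = 0 := by
    rw [← hu.mul_left_eq_zero, ← map_mul, he.mul_one_sub_self, map_zero]
  refine ⟨C, h, Hom.ext (AlgHom.ext fun x ↦ ?_)⟩
  have hx : Hom.toAlgHom f x - Hom.toAlgHom g x ∈ Ideal.span {e} :=
    hspan ▸ Ideal.subset_span ⟨x, rfl⟩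
  obtain ⟨y, hy⟩ := Ideal.mem_span_singleton.mp hx
  have : Hom.toAlgHom h (Hom.toAlgHom f x - Hom.toAlgHom g x) = 0 := by simp [hy, hhe]
  rwa [map_sub, sub_eq_zero] at this

instance : Nonempty (EtaleNhd R) :=
  ⟨(exists_algEquiv_of_algHom_residueField R (Algebra.ofId R _)).choose⟩

instance : IsFiltered (EtaleNhd R) where
  cocone_objs A B := by
    obtain ⟨C, ⟨f⟩, ⟨g⟩⟩ := exists_nonempty_hom_nonempty_hom A B
    exact ⟨C, f, g, trivial⟩
  cocone_maps _ _ f g := exists_comp_eq_comp f g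

theorem isLocalHom_algebraMap_localization (A : EtaleNhd R) :
    IsLocalHom (algebraMap R (Localization.AtPrime A.q)) := by
  refine ((local_hom_TFAE _).out 0 4 rfl rfl).mpr ?_
  rw [IsScalarTower.algebraMap_eq R A.Ring, ← Ideal.comap_comap, ← Ideal.under_def A.Ring,
    Localization.AtPrime.under_maximalIdeal]
  exact (A.q.over_def (maximalIdeal R)).symm

theorem map_maximalIdeal_localization (A : EtaleNhd R) :
    (maximalIdeal R).map (algebraMap R (Localization.AtPrime A.q)) =
      maximalIdeal (Localization.AtPrime A.q) := by
  have := A.isLocalHom_algebraMap_localization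
  have : Algebra.FormallyEtale A.Ring (Localization.AtPrime A.q) :=
    .of_isLocalization A.q.primeCompl
  have : Algebra.FormallyEtale R (Localization.AtPrime A.q) := .comp R A.Ring _
  have : Algebra.EssFiniteType A.Ring (Localization.AtPrime A.q) :=
    .of_isLocalization _ A.q.primeCompl
  have : Algebra.EssFiniteType R (Localization.AtPrime A.q) := .comp R A.Ring _
  exact Algebra.FormallyUnramified.map_maximalIdeal (R := R) (S := Localization.AtPrime A.q)

theorem isPureAlgebra_localization (A : EtaleNhd R) :
    IsPureAlgebra R (Localization.AtPrime A.q) := by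
  have := A.isLocalHom_algebraMap_localization
  have : Module.Flat R (Localization.AtPrime A.q) := .trans R A.Ring _
  exact .of_flat_of_isLocalHom

end EtaleNhd

/-! ### The Henselization -/

namespace Henselization

variable {R : Type u} [CommRing R] [IsLocalRing R]

open EtaleNhd

/-- The canonical map from an étale neighbourhood to the Henselization. -/
noncomputable def ι (A : EtaleNhd R) : A.Ring →+* Henselization R :=
  (Limits.colimit.ι (forgetToRing R) A).hom

theorem ι_toAlgHom {A B : EtaleNhd R} (f : A ⟶ B) (x : A.Ring) :
    ι B (Hom.toAlgHom f x) = ι A x :=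
  congrArg (fun g ↦ g.hom x) (Limits.colimit.w (forgetToRing R) f)

theorem ι_algebraMap_eq (A B : EtaleNhd R) (r : R) :
    ι A (algebraMap R A.Ring r) = ι B (algebraMap R B.Ring r) := by
  obtain ⟨C, ⟨f⟩, ⟨g⟩⟩ := exists_nonempty_hom_nonempty_hom A B
  rw [← ι_toAlgHom f, ← ι_toAlgHom g, AlgHom.commutes, AlgHom.commutes]

noncomputable instance : Algebra R (Henselization R) :=
  ((ι (Classical.arbitrary (EtaleNhd R))).comp (algebraMap R _)).toAlgebra

/-- The map `ι` as a homomorphism of `R`-algebras. -/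
noncomputable def ιₐ (A : EtaleNhd R) : A.Ring →ₐ[R] Henselization R where
  __ := ι A
  commutes' := ι_algebraMap_eq A _

theorem ιₐ_toAlgHom {A B : EtaleNhd R} (f : A ⟶ B) (x : A.Ring) :
    ιₐ B (Hom.toAlgHom f x) = ιₐ A x :=
  ι_toAlgHom f x

theorem nonempty_algHom_of_cocone {C : Type u} [CommRing C] [Algebra R C]
    (f : ∀ A : EtaleNhd R, A.Ring →ₐ[R] C)
    (hf : ∀ {A B : EtaleNhd R} (g : A ⟶ B), (f B).comp (Hom.toAlgHom g) = f A) :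
    Nonempty (Henselization R →ₐ[R] C) := by
  let c : Limits.Cocone (forgetToRing R) :=
    { pt := CommRingCat.of C
      ι := { app := fun A ↦ CommRingCat.ofHom (f A).toRingHom
             naturality := fun A B g ↦ by ext x; exact DFunLike.congr_fun (hf g) x } }
  let A : EtaleNhd R := Classical.arbitrary _
  exact ⟨{ (Limits.colimit.desc (forgetToRing R) c).hom with
    commutes' := fun r ↦ (congrArg (fun g ↦ g.hom (algebraMap R A.Ring r))
      (Limits.colimit.ι_desc c A)).trans ((f A).commutes r) }⟩

theorem exists_ιₐ_eq (x : Henselization R) : ∃ (A : EtaleNhd R) (a : A.Ring), ιₐ A a = x :=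
  Limits.Concrete.colimit_exists_rep (forgetToRing R) x

theorem exists_forall_ιₐ_eq {κ : Type*} [Finite κ] (x : κ → Henselization R) :
    ∃ (A : EtaleNhd R) (a : κ → A.Ring), ∀ i, ιₐ A (a i) = x i := by
  classical
  cases nonempty_fintype κ
  choose A a ha using fun i ↦ exists_ιₐ_eq (x i)
  obtain ⟨B, hB⟩ := IsFiltered.sup_objs_exists (Finset.univ.image A)
  have f (i : κ) : A i ⟶ B := (hB (Finset.mem_image_of_mem A (Finset.mem_univ i))).some
  exact ⟨B, fun i ↦ Hom.toAlgHom (f i) (a i), fun i ↦ (ιₐ_toAlgHom (f i) (a i)).trans (ha i)⟩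

theorem exists_hom_eq {A : EtaleNhd R} {x y : A.Ring} (h : ιₐ A x = ιₐ A y) :
    ∃ (B : EtaleNhd R) (f : A ⟶ B), Hom.toAlgHom f x = Hom.toAlgHom f y := by
  obtain ⟨B, f, g, hfg : Hom.toAlgHom f x = Hom.toAlgHom g y⟩ :=
    Limits.Concrete.colimit_exists_of_rep_eq (forgetToRing R) x y h
  obtain ⟨C, k, hk⟩ := exists_comp_eq_comp f g
  refine ⟨C, f ≫ k, ?_⟩
  calc Hom.toAlgHom (f ≫ k) x = Hom.toAlgHom (g ≫ k) y := congrArg (Hom.toAlgHom k) hfg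
    _ = Hom.toAlgHom (f ≫ k) y := by rw [hk]

theorem exists_hom_forall_eq {A : EtaleNhd R} {κ : Type*} [Finite κ] {x y : κ → A.Ring}
    (h : ∀ i, ιₐ A (x i) = ιₐ A (y i)) :
    ∃ (B : EtaleNhd R) (f : A ⟶ B), ∀ i, Hom.toAlgHom f (x i) = Hom.toAlgHom f (y i) := by
  classical
  cases nonempty_fintype κ
  suffices ∀ s : Finset κ, ∃ (B : EtaleNhd R) (f : A ⟶ B),
      ∀ i ∈ s, Hom.toAlgHom f (x i) = Hom.toAlgHom f (y i) by
    simpa using this Finset.univ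
  intro s
  induction s using Finset.induction_on with
  | empty => exact ⟨A, 𝟙 A, by simp⟩
  | insert i s _ ih =>
    obtain ⟨B, f, hf⟩ := ih
    obtain ⟨C, g, hg⟩ : ∃ (C : EtaleNhd R) (g : B ⟶ C),
        Hom.toAlgHom g (Hom.toAlgHom f (x i)) = Hom.toAlgHom g (Hom.toAlgHom f (y i)) :=
      exists_hom_eq (by simpa only [ιₐ_toAlgHom] using h i)
    exact ⟨C, f ≫ g, Finset.forall_mem_insert _ _ _ |>.mpr
      ⟨hg, fun j hj ↦ congrArg (Hom.toAlgHom g) (hf j hj)⟩⟩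

theorem isUnit_ιₐ (A : EtaleNhd R) {s : A.Ring} (hs : s ∉ A.q) : IsUnit (ιₐ A s) := by
  obtain ⟨C, f, hf⟩ := A.exists_hom_isUnit hs
  exact ιₐ_toAlgHom f s ▸ hf.map (ιₐ C)

noncomputable instance (A : EtaleNhd R) :
    Algebra (Localization.AtPrime A.q) (Henselization R) :=
  (IsLocalization.liftAlgHom (M := A.q.primeCompl) (f := ιₐ A)
    fun s ↦ isUnit_ιₐ A s.2).toRingHom.toAlgebra

theorem algebraMap_localization_algebraMap (A : EtaleNhd R) (a : A.Ring) :
    algebraMap (Localization.AtPrime A.q) (Henselization R) (algebraMap A.Ring _ a) = ιₐ A a := by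
  simp [RingHom.algebraMap_toAlgebra]

instance (A : EtaleNhd R) : IsScalarTower R (Localization.AtPrime A.q) (Henselization R) :=
  .of_algebraMap_eq fun r ↦ by
    rw [IsScalarTower.algebraMap_apply R A.Ring (Localization.AtPrime A.q),
      algebraMap_localization_algebraMap, AlgHom.commutes]

theorem exists_hom_exists_forall_sum_eq (A : EtaleNhd R) {ι κ : Type} [Finite ι] [Fintype κ]
    {M : ι → κ → A.Ring} {r : ι → A.Ring} {t : κ → Henselization R}
    (ht : ∀ i, ∑ j, ιₐ A (M i j) * t j = ιₐ A (r i)) :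
    ∃ (B : EtaleNhd R) (f : A ⟶ B) (s : κ → B.Ring),
      ∀ i, ∑ j, Hom.toAlgHom f (M i j) * s j = Hom.toAlgHom f (r i) := by
  obtain ⟨B, b, hb⟩ := exists_forall_ιₐ_eq t
  obtain ⟨C, ⟨f⟩, ⟨g⟩⟩ := exists_nonempty_hom_nonempty_hom A B
  obtain ⟨D, h, hD⟩ := exists_hom_forall_eq (A := C)
    (x := fun i ↦ ∑ j, Hom.toAlgHom f (M i j) * Hom.toAlgHom g (b j))
    (y := fun i ↦ Hom.toAlgHom f (r i)) fun i ↦ by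
      simpa only [map_sum, map_mul, ιₐ_toAlgHom, hb] using ht i
  refine ⟨D, f ≫ h, fun j ↦ Hom.toAlgHom h (Hom.toAlgHom g (b j)), fun i ↦ ?_⟩
  simpa only [map_sum, map_mul] using! hD i

theorem isPureAlgebra_localization (A : EtaleNhd R) :
    IsPureAlgebra (Localization.AtPrime A.q) (Henselization R) := by
  algebraize [(ιₐ A).toRingHom]
  have : IsScalarTower A.Ring (Localization.AtPrime A.q) (Henselization R) :=
    .of_algebraMap_eq fun a ↦ (algebraMap_localization_algebraMap A a).symm
  refine .of_isLocalization A.q.primeCompl _ ?_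
  rintro ι κ _ _ M r ⟨t, ht⟩
  obtain ⟨B, f, s, hs⟩ := exists_hom_exists_forall_sum_eq A (M := M) (r := r) (t := t) ht
  algebraize [(Hom.toAlgHom f).toRingHom]
  have : IsScalarTower R A.Ring B.Ring := .of_algebraMap_eq' (Hom.toAlgHom f).comp_algebraMap.symm
  have : Algebra.Etale A.Ring B.Ring := .of_restrictScalars R _ _
  have : B.q.LiesOver A.q := ⟨f.comap_eq.symm⟩
  exact IsPureAlgebra.exists_sum_smul_eq_localization_of_flat A.q B.q (t := s) hs

theorem isPureAlgebra : IsPureAlgebra R (Henselization R) :=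
  let A : EtaleNhd R := Classical.arbitrary _
  A.isPureAlgebra_localization.trans (isPureAlgebra_localization A)

theorem ιₐ_mem_map_maximalIdeal (A : EtaleNhd R) {a : A.Ring} (ha : a ∈ A.q) :
    ιₐ A a ∈ (maximalIdeal R).map (algebraMap R (Henselization R)) := by
  rw [IsScalarTower.algebraMap_eq R (Localization.AtPrime A.q), ← Ideal.map_map,
    map_maximalIdeal_localization, ← algebraMap_localization_algebraMap]
  exact Ideal.mem_map_of_mem _
    ((IsLocalization.AtPrime.to_map_mem_maximal_iff (Localization.AtPrime A.q) A.q a).mpr ha)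

theorem exists_sub_mem_map_maximalIdeal (x : Henselization R) :
    ∃ r : R, x - algebraMap R _ r ∈ (maximalIdeal R).map (algebraMap R (Henselization R)) := by
  obtain ⟨A, a, rfl⟩ := exists_ιₐ_eq x
  obtain ⟨r, hr⟩ := A.exists_sub_mem a
  exact ⟨r, by simpa using ιₐ_mem_map_maximalIdeal A hr⟩

theorem map_maximalIdeal_ne_top :
    (maximalIdeal R).map (algebraMap R (Henselization R)) ≠ ⊤ := fun h ↦
  (maximalIdeal.isMaximal R).ne_top (by rw [← isPureAlgebra.comap_map_eq (maximalIdeal R), h]; rfl)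

theorem mem_map_maximalIdeal_iff {x : Henselization R} :
    x ∈ (maximalIdeal R).map (algebraMap R (Henselization R)) ↔ x ∈ nonunits (Henselization R) := by
  refine ⟨fun hx hu ↦ map_maximalIdeal_ne_top (Ideal.eq_top_of_isUnit_mem _ hx hu), ?_⟩
  obtain ⟨A, a, rfl⟩ := exists_ιₐ_eq x
  exact fun hu ↦ ιₐ_mem_map_maximalIdeal A (by_contra fun ha ↦ hu (isUnit_ιₐ A ha))

instance : IsLocalRing (Henselization R) :=
  have : Nontrivial (Henselization R) :=
    ⟨1, 0, fun h ↦ map_maximalIdeal_ne_top ((Ideal.eq_top_iff_one _).mpr (h ▸ zero_mem _))⟩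
  .of_nonunits_add fun a b ha hb ↦ by
    rw [← mem_map_maximalIdeal_iff] at *
    exact add_mem ha hb

theorem map_maximalIdeal :
    (maximalIdeal R).map (algebraMap R (Henselization R)) = maximalIdeal (Henselization R) :=
  Ideal.ext fun _ ↦ mem_map_maximalIdeal_iff

/-- Finitely generated ideals of `Rʰ` come from the local ring of an étale neighbourhood, where
Krull's intersection theorem applies. -/
theorem mem_of_forall_mem_sup_map_pow [IsNoetherianRing R] {J : Ideal (Henselization R)}
    (hJ : J.FG) {y : Henselization R}
    (h : ∀ k, y ∈ J ⊔ (maximalIdeal R ^ k).map (algebraMap R (Henselization R))) : y ∈ J := by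
  obtain ⟨n, x, rfl⟩ := Submodule.fg_iff_exists_fin_generating_family.mp hJ
  obtain ⟨A, a, ha⟩ := exists_forall_ιₐ_eq (fun i : Option (Fin n) ↦ i.elim y x)
  let L := Localization.AtPrime A.q
  have : IsNoetherianRing A.Ring := Algebra.FiniteType.isNoetherianRing R _
  have : IsNoetherianRing L := IsLocalization.isNoetherianRing A.q.primeCompl L inferInstance
  let J' : Ideal L := Ideal.span (Set.range fun i ↦ algebraMap A.Ring L (a (some i)))
  have hJ' : J'.map (algebraMap L (Henselization R)) = Ideal.span (Set.range x) := by
    rw [Ideal.map_span, ← Set.range_comp]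
    exact congrArg _ (congrArg _ (funext fun i ↦
      (algebraMap_localization_algebraMap A _).trans (ha (some i))))
  have hy : algebraMap L (Henselization R) (algebraMap A.Ring L (a none)) = y :=
    (algebraMap_localization_algebraMap A _).trans (ha none)
  suffices algebraMap A.Ring L (a none) ∈ J' by
    rw [← Ideal.span, ← hJ', ← hy]
    exact Ideal.mem_map_of_mem _ this
  refine mem_of_forall_mem_sup_pow_smul_top (R := L) (M := L) (N := J')
    (maximalIdeal_le_jacobson ⊥) fun k ↦ ?_
  rw [smul_eq_mul, Ideal.mul_top, ← (isPureAlgebra_localization A).comap_map_eq (_ ⊔ _),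
    Ideal.mem_comap, hy, Ideal.map_sup, hJ', ← map_maximalIdeal_localization, ← Ideal.map_pow,
    Ideal.map_map, ← IsScalarTower.algebraMap_eq]
  exact h k

instance [IsNoetherianRing R] : IsNoetherianRing (Henselization R) :=
  isNoetherianRing_of_dense exists_sub_mem_map_maximalIdeal
    fun _ hJ _ ↦ mem_of_forall_mem_sup_map_pow hJ

theorem nonempty_algHom (C : Type u) [CommRing C] [Algebra R C] [HenselianLocalRing C]
    [IsLocalHom (algebraMap R C)] : Nonempty (Henselization R →ₐ[R] C) := by
  let π := IsScalarTower.toAlgHom R C (ResidueField C)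
  have hker : maximalIdeal R ≤ RingHom.ker (Algebra.ofId R (ResidueField C)) := fun r hr ↦ by
    rw [RingHom.mem_ker, Algebra.ofId_apply, IsScalarTower.algebraMap_apply R C,
      ResidueField.algebraMap_eq, residue_eq_zero_iff]
    simpa using hr
  let j : (maximalIdeal R).ResidueField →ₐ[R] ResidueField C :=
    Ideal.ResidueField.liftₐ (maximalIdeal R) (Algebra.ofId R (ResidueField C)) hker fun r hr ↦
      IsUnit.map (Algebra.ofId R (ResidueField C)) (by simpa [Ideal.primeCompl] using hr)
  choose f hf using fun A : EtaleNhd R ↦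
    exists_algHom_residue_comp_eq (C := C) (j.comp A.residueMap)
  refine nonempty_algHom_of_cocone f fun {A B} g ↦ algHom_ext_of_sub_mem_maximalIdeal fun x ↦ ?_
  have hπ : π.comp ((f B).comp (Hom.toAlgHom g)) = π.comp (f A) := by
    rw [← AlgHom.comp_assoc, hf, hf, AlgHom.comp_assoc, residueMap_comp]
  rw [← residue_eq_zero_iff, map_sub, sub_eq_zero]
  exact DFunLike.congr_fun hπ x

end Henselization

/-! ### Splinters and integral extensions -/

theorem nonempty_algHom_of_comap_surjective {A T Ω : Type*} [CommRing A] [CommRing T] [Algebra A T]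
    [Algebra.IsIntegral A T] (h : Function.Surjective (PrimeSpectrum.comap (algebraMap A T)))
    [Field Ω] [IsAlgClosed Ω] [Algebra A Ω] : Nonempty (T →ₐ[A] Ω) := by
  let p : Ideal A := RingHom.ker (algebraMap A Ω)
  have hp : p.IsPrime := RingHom.ker_isPrime _
  obtain ⟨Q, hQ⟩ := h ⟨p, hp⟩
  have : Q.asIdeal.LiesOver p := ⟨congrArg PrimeSpectrum.asIdeal hQ.symm⟩
  algebraize [Ideal.Quotient.lift p (algebraMap A Ω) fun _ h ↦ h]
  have hinj : Function.Injective (algebraMap (A ⧸ p) Ω) :=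
    RingHom.kerLift_injective (algebraMap A Ω)
  have : FaithfulSMul (A ⧸ p) Ω := (faithfulSMul_iff_algebraMap_injective _ _).mpr hinj
  have : IsScalarTower A (A ⧸ p) Ω := .of_algebraMap_eq' rfl
  have : IsDomain (A ⧸ p) := Ideal.Quotient.isDomain p
  have : IsDomain (T ⧸ Q.asIdeal) := Ideal.Quotient.isDomain _
  have : Module.IsTorsionFree (A ⧸ p) (T ⧸ Q.asIdeal) :=
    Module.isTorsionFree_iff_faithfulSMul.mpr inferInstance
  have : Module.IsTorsionFree (A ⧸ p) Ω := Module.isTorsionFree_iff_faithfulSMul.mpr inferInstance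
  let f : T ⧸ Q.asIdeal →ₐ[A ⧸ p] Ω := IsAlgClosed.lift
  exact ⟨(f.restrictScalars A).comp (Ideal.Quotient.mkₐ A Q.asIdeal)⟩

theorem comap_algebraMap_baseChange_surjective {A T B : Type*} [CommRing A] [CommRing T]
    [Algebra A T] [Algebra.IsIntegral A T]
    (h : Function.Surjective (PrimeSpectrum.comap (algebraMap A T))) [CommRing B] [Algebra A B] :
    Function.Surjective (PrimeSpectrum.comap (algebraMap B (B ⊗[A] T))) := by
  intro P
  let Ω := AlgebraicClosure P.asIdeal.ResidueField
  obtain ⟨f⟩ := nonempty_algHom_of_comap_surjective h (Ω := Ω)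
  let g : B ⊗[A] T →ₐ[A] Ω :=
    Algebra.TensorProduct.lift (IsScalarTower.toAlgHom A B Ω) f fun _ _ ↦ .all _ _
  refine ⟨⟨RingHom.ker g, RingHom.ker_isPrime _⟩, PrimeSpectrum.ext (Ideal.ext fun b ↦ ?_)⟩
  have hg : g (algebraMap B _ b) = algebraMap B Ω b := by simp [g]
  rw [PrimeSpectrum.comap_asIdeal, Ideal.mem_comap, RingHom.mem_ker, hg,
    IsScalarTower.algebraMap_apply B P.asIdeal.ResidueField Ω, map_eq_zero,
    Ideal.algebraMap_residueField_eq_zero]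

theorem comap_algebraMap_pi_quotient_minimalPrimes_surjective (R : Type*) [CommRing R] :
    Function.Surjective
      (PrimeSpectrum.comap (algebraMap R (∀ p : minimalPrimes R, R ⧸ p.1))) := by
  intro P
  obtain ⟨p, hp, hpP⟩ := Ideal.exists_minimalPrimes_le (bot_le : ⊥ ≤ P.asIdeal)
  obtain ⟨Q, hQ⟩ : P ∈ Set.range (PrimeSpectrum.comap (Ideal.Quotient.mk p)) := by
    rw [range_comap_of_surjective _ _ Ideal.Quotient.mk_surjective]
    simpa using hpP
  exact ⟨PrimeSpectrum.comap (Pi.evalRingHom (fun p : minimalPrimes R ↦ R ⧸ p.1) ⟨p, hp⟩) Q, hQ⟩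

namespace IsSplinter

variable {R : Type u} [CommRing R]

/-- A left inverse of `R → ∏ R/p`, the product over the minimal primes, takes a unit value at some
idempotent `e_p`, which is annihilated by `p`. -/
theorem isDomain [IsLocalRing R] (hR : IsSplinter R) : IsDomain R := by
  classical
  have := hR.isNoetherianRing
  have : Finite (minimalPrimes R) := minimalPrimes.finite_of_isNoetherianRing R
  cases nonempty_fintype (minimalPrimes R)
  let S := ∀ p : minimalPrimes R, R ⧸ p.1
  obtain ⟨φ, hφ⟩ := hR.exists_leftInverse S inferInstance
    (comap_algebraMap_pi_quotient_minimalPrimes_surjective R)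
  have hsum : ∑ p, φ (Pi.single p 1) = 1 := by
    rw [← map_sum, Finset.univ_sum_single (fun p : minimalPrimes R ↦ (1 : R ⧸ p.1))]
    simpa using! DFunLike.congr_fun hφ 1
  obtain ⟨p, hp⟩ : ∃ p, IsUnit (φ (Pi.single p 1)) := by
    by_contra! h
    exact (Ideal.ne_top_iff_one _).mp (maximalIdeal.isMaximal R).ne_top
      (hsum ▸ sum_mem fun p _ ↦ h p)
  have hbot : p.1 = ⊥ := by
    refine eq_bot_iff.mpr fun x hx ↦ hp.mul_left_eq_zero.mp ?_
    have hx' : x • (Pi.single p 1 : S) = 0 := by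
      rw [← Pi.single_smul, Algebra.smul_def, mul_one, Ideal.Quotient.algebraMap_eq,
        Ideal.Quotient.eq_zero_iff_mem.mpr hx, Pi.single_zero]
    rw [← smul_eq_mul, ← map_smul, hx', map_zero]
  have : (⊥ : Ideal R).IsPrime := hbot ▸ Ideal.IsMinimalPrime.isPrime p.2
  exact IsDomain.of_bot_isPrime R

theorem isPureAlgebra_of_isIntegral (hR : IsSplinter R) (E : Type u) [CommRing E] [Algebra R E]
    [Algebra.IsIntegral R E] [FaithfulSMul R E] : IsPureAlgebra R E := by
  rintro ι κ _ _ M r ⟨t, ht⟩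
  let S := Algebra.adjoin R (Set.range t)
  have : Module.Finite R S := Algebra.finite_adjoin_of_finite_of_isIntegral (Set.finite_range t)
    fun x _ ↦ Algebra.IsIntegral.isIntegral x
  have : FaithfulSMul R S := .tower_bot R S E
  obtain ⟨φ, hφ⟩ := hR.exists_leftInverse S inferInstance (Algebra.IsIntegral.comap_surjective R S)
  exact IsPureAlgebra.of_leftInverse hφ M r
    ⟨fun j ↦ ⟨t j, Algebra.subset_adjoin ⟨j, rfl⟩⟩, fun i ↦ Subtype.ext (by simpa using ht i)⟩

end IsSplinter

section IsIntegrallyClosed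

open Polynomial

theorem splits_of_monic_of_isIntegrallyClosed {B : Type*} [CommRing B] [IsDomain B]
    [IsIntegrallyClosed B] (F : Type*) [Field F] [Algebra B F] [IsFractionRing B F] [IsAlgClosed F]
    {f : B[X]} (hf : f.Monic) : f.Splits :=
  .of_splits_map_of_injective (IsFractionRing.injective B F) (IsAlgClosed.splits _) fun a ha ↦
    IsIntegrallyClosed.isIntegral_iff.mp ⟨f, hf, by
      rw [← Polynomial.eval_map]
      exact (mem_roots'.mp ha).2⟩

theorem henselianLocalRing_of_forall_monic_splits {B : Type*} [CommRing B] [IsLocalRing B]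
    (h : ∀ f : B[X], f.Monic → f.Splits) : HenselianLocalRing B where
  is_henselian f hf a ha _ := by
    obtain ⟨s, hs⟩ := splits_iff_exists_multiset.mp (h f hf)
    rw [hf.leadingCoeff, C_1, one_mul] at hs
    have heval (x : B) : f.eval x = (s.map fun b ↦ x - b).prod := by
      simp [hs, eval_multiset_prod]
    rw [heval] at ha
    obtain ⟨c, hc, hca⟩ :=
      ((maximalIdeal.isMaximal B).isPrime.multiset_prod_mem_iff_exists_mem _).mp ha
    obtain ⟨b, hb, rfl⟩ := Multiset.mem_map.mp hc
    refine ⟨b, ?_, by simpa using neg_mem hca⟩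
    rw [IsRoot, heval]
    exact Multiset.prod_eq_zero (Multiset.mem_map.mpr ⟨b, hb, sub_self b⟩)

end IsIntegrallyClosed

theorem nonempty_algHom_of_isIntegrallyClosed {A T B : Type*} [CommRing A] [CommRing T]
    [Algebra A T] [Algebra.IsIntegral A T]
    (h : Function.Surjective (PrimeSpectrum.comap (algebraMap A T))) [CommRing B] [IsDomain B]
    [IsIntegrallyClosed B] [Algebra A B] (F : Type*) [Field F] [Algebra B F] [IsFractionRing B F]
    [IsAlgClosed F] : Nonempty (T →ₐ[A] B) := by
  algebraize [(algebraMap B F).comp (algebraMap A B)]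
  obtain ⟨f⟩ := nonempty_algHom_of_comap_surjective h (Ω := F)
  have hf (x : T) : f x ∈ (IsScalarTower.toAlgHom A B F).range :=
    IsIntegrallyClosed.isIntegral_iff.mp
      ((Algebra.IsIntegral.isIntegral (R := A) x).map f).tower_top
  let e := AlgEquiv.ofInjective (IsScalarTower.toAlgHom A B F) (IsFractionRing.injective B F)
  exact ⟨e.symm.toAlgHom.comp (f.codRestrict _ hf)⟩

/-- The absolute integral closure `R⁺` of a domain `R`: its integral closure in an algebraic closure
of its fraction field. -/
noncomputable abbrev AbsoluteIntegralClosure (R : Type*) [CommRing R] [IsDomain R] :=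
  integralClosure R (AlgebraicClosure (FractionRing R))

namespace AbsoluteIntegralClosure

variable (R : Type*) [CommRing R] [IsDomain R]

instance : FaithfulSMul R (AlgebraicClosure (FractionRing R)) :=
  .trans R (FractionRing R) _

instance : FaithfulSMul R (AbsoluteIntegralClosure R) :=
  .tower_bot R _ (AlgebraicClosure (FractionRing R))

instance : IsFractionRing (AbsoluteIntegralClosure R) (AlgebraicClosure (FractionRing R)) :=
  have : Algebra.IsAlgebraic R (AlgebraicClosure (FractionRing R)) :=
    IsFractionRing.comap_isAlgebraic_iff.mpr
      (inferInstance : Algebra.IsAlgebraic (FractionRing R) (AlgebraicClosure (FractionRing R)))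
  integralClosure.isFractionRing_of_algebraic fun _ hx ↦
    (FaithfulSMul.algebraMap_eq_zero_iff R _).mp hx

instance : IsAlgClosed (FractionRing (AbsoluteIntegralClosure R)) :=
  .of_ringEquiv (AlgebraicClosure (FractionRing R)) _ (FractionRing.algEquiv _ _).symm.toRingEquiv

instance : IsIntegrallyClosed (AbsoluteIntegralClosure R) :=
  (IsIntegrallyClosed.integralClosure_eq_bot_iff (AlgebraicClosure (FractionRing R))).mp
    integralClosure_idem

end AbsoluteIntegralClosure

theorem isLocalHom_algebraMap_localization_of_isIntegral {R E : Type*} [CommRing R] [IsLocalRing R]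
    [CommRing E] [Algebra R E] [Algebra.IsIntegral R E] (n : Ideal E) [n.IsMaximal] :
    IsLocalHom (algebraMap R (Localization.AtPrime n)) := by
  refine ((local_hom_TFAE _).out 0 4 rfl rfl).mpr (eq_maximalIdeal ?_)
  rw [IsScalarTower.algebraMap_eq R E, ← Ideal.comap_comap, ← Ideal.under_def E,
    IsLocalization.AtPrime.under_maximalIdeal _ n]
  exact Ideal.isMaximal_comap_of_isIntegral_of_isMaximal n

section Localization

variable {E : Type*} [CommRing E] [IsDomain E] [IsIntegrallyClosed E] (n : Ideal E) [n.IsPrime]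

theorem isIntegrallyClosed_localization : IsIntegrallyClosed (Localization.AtPrime n) :=
  isIntegrallyClosed_of_isLocalization _ n.primeCompl n.primeCompl_le_nonZeroDivisors

theorem henselianLocalRing_localization [IsAlgClosed (FractionRing E)] :
    HenselianLocalRing (Localization.AtPrime n) :=
  have := isIntegrallyClosed_localization n
  henselianLocalRing_of_forall_monic_splits fun _ ↦
    splits_of_monic_of_isIntegrallyClosed (FractionRing E)

theorem nonempty_algHom_localization [IsAlgClosed (FractionRing E)] {A T : Type*} [CommRing A]
    [CommRing T] [Algebra A T] [Algebra.IsIntegral A T]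
    (h : Function.Surjective (PrimeSpectrum.comap (algebraMap A T)))
    [Algebra A (Localization.AtPrime n)] : Nonempty (T →ₐ[A] Localization.AtPrime n) :=
  have := isIntegrallyClosed_localization n
  nonempty_algHom_of_isIntegrallyClosed h (FractionRing E)

end Localization

namespace IsSplinter

variable {R : Type u} [CommRing R] [IsLocalRing R]

theorem of_henselization (h : IsSplinter (Henselization R)) : IsSplinter R := by
  have := h.isNoetherianRing
  have := Henselization.isPureAlgebra (R := R) |>.isNoetherianRing
  refine ⟨inferInstance, fun S _ _ _ hS ↦ ?_⟩
  obtain ⟨φ, hφ⟩ := h.exists_leftInverse (Henselization R ⊗[R] S) inferInstance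
    (comap_algebraMap_baseChange_surjective hS)
  have hpure : IsPureAlgebra R (Henselization R ⊗[R] S) :=
    Henselization.isPureAlgebra.trans (.of_leftInverse hφ)
  exact (hpure.of_algHom Algebra.TensorProduct.includeRight).exists_leftInverse

theorem henselization (hR : IsSplinter R) : IsSplinter (Henselization R) := by
  have := hR.isNoetherianRing
  have := hR.isDomain
  refine ⟨inferInstance, fun T _ _ _ hT ↦ ?_⟩
  let E := AbsoluteIntegralClosure R
  have f (n : MaximalSpectrum E) : Henselization R →ₐ[R] Localization.AtPrime n.asIdeal :=
    have := henselianLocalRing_localization n.asIdeal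
    have := isLocalHom_algebraMap_localization_of_isIntegral (R := R) n.asIdeal
    (Henselization.nonempty_algHom _).some
  let _ (n : MaximalSpectrum E) : Algebra (Henselization R) (Localization.AtPrime n.asIdeal) :=
    (f n).toRingHom.toAlgebra
  have (n : MaximalSpectrum E) :
      IsScalarTower R (Henselization R) (Localization.AtPrime n.asIdeal) :=
    .of_algebraMap_eq' (f n).comp_algebraMap.symm
  have hpure : IsPureAlgebra R (MaximalSpectrum.PiLocalization E) :=
    (hR.isPureAlgebra_of_isIntegral E).trans .piLocalization
  have hpure' : IsPureAlgebra (Henselization R) (MaximalSpectrum.PiLocalization E) :=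
    hpure.of_dense Henselization.exists_sub_mem_map_maximalIdeal
      (Henselization.map_maximalIdeal.trans_le (maximalIdeal_le_jacobson ⊥))
  have g (n : MaximalSpectrum E) : T →ₐ[Henselization R] Localization.AtPrime n.asIdeal :=
    (nonempty_algHom_localization n.asIdeal hT).some
  exact (hpure'.of_algHom (AlgHom.pi g)).exists_leftInverse

end IsSplinter

theorem theoremB_general (R : Type u) [CommRing R] [IsLocalRing R] :
    IsSplinter R ↔ IsSplinter (Henselization R) :=
  ⟨IsSplinter.henselization, IsSplinter.of_henselization⟩

theorem theoremB (R : Type u) [CommRing R] [IsLocalRing R] [IsNoetherianRing R] :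
    IsSplinter R ↔ IsSplinter (Henselization R) :=
  theoremB_general R
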